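/- Let $n\ge 1$ and let $q_{ij}\ge 0$ ($1\le i,j\le n$, $i\ne j$) be arbitrary non-negative real numbers, $q_{ij}$ being the rate constant of the transition $A_j\to A_i$. Let $K=(k_{ij})$ be the real $n\times n$ matrix of the master equation $\dot p_i=\sum_{j\ne i}(q_{ij}p_j-q_{ji}p_i)$, that is, $k_{ij}=q_{ij}$ for $i\ne j$ and $k_{ii}=-\sum_{m\ne i}q_{mi}$. Then every nonzero complex eigenvalue $\lambda$ of $K$ satisfies $\operatorname{Re}\lambda\neq 0$ and $$\frac{|\operatorname{Im}\lambda|}{|\operatorname{Re}\lambda|}\le\cot\frac{\pi}{n}.$$ (For $n=1$ one has $K=0$, so there is no nonzero eigenvalue and nothing is claimed.) The bound is sharp for every $n\ge 2$: for each $q>0$, the number $\lambda=-q\,(1-e^{2\pi i/n})$ is a nonzero eigenvalue, with $\operatorname{Re}\lambda\ne 0$, of the matrix $K$ of the simple irreversible cycle $A_1\to A_2\to\cdots\to A_n\to A_1$ with equal rate constants ($q_{j+1,j}=q_{1n}=q$, all other $q_{ij}=0$), and for it $$\frac{|\operatorname{Im}\lambda|}{|\operatorname{Re}\lambda|}=\cot\frac{\pi}{n}.$$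 -/

import Mathlib

/-- The matrix `K` of the master equation
`dp_i/dt = ∑_{j ≠ i} (q i j * p_j - q j i * p_i)` on `n` states, where `q i j` (`i ≠ j`) is the
rate constant of the transition `A_j → A_i`. Diagonal values of `q` are not used. -/
def masterMatrix {n : ℕ} (q : Fin n → Fin n → ℝ) : Matrix (Fin n) (Fin n) ℝ :=
  Matrix.of fun i j =>
    if i = j then -∑ m ∈ Finset.univ.filter (fun m => m ≠ i), q m i else q i j

/-- Rate constants of the simple irreversible cycle `A_1 → A_2 → ⋯ → A_n → A_1` (states are
numbered `0, …, n - 1`), all transitions having rate constant `r`. -/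
def cycleRate (n : ℕ) (r : ℝ) : Fin n → Fin n → ℝ :=
  fun i j => if (i : ℕ) = ((j : ℕ) + 1) % n then r else 0

/-- `z` is a complex eigenvalue of the real square matrix `K`. -/
def IsComplexEigenvalue {n : ℕ} (K : Matrix (Fin n) (Fin n) ℝ) (z : ℂ) : Prop :=
  Module.End.HasEigenvalue (Matrix.toLin' (K.map (fun x : ℝ => (x : ℂ)))) z

/-!
An eigenvalue `z` of `K` has a left eigenvector `w`, and then `∑ i, q i j * (w i - w j) = z * w j`
for all `j`. Hence, if `w j ≠ 0`, `z` is a nonnegative combination of the numbers `u - 1` with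
`u = w i / w j`. If `z.im ≠ 0`, put `τ = -z.re / z.im`; the functional `x ↦ x.re + τ * x.im`
vanishes at `z ≠ 0`, so it is nonnegative at some `u - 1 ≠ 0`. This selects for every `j` with
`w j ≠ 0` a successor `i` of the same kind. On a set of indices permuted by the successor map, the
ratios `u` have product `1`.

With `b = arctan τ`, the selected half-plane is `cos b ≤ ‖u‖ * cos (arg u - b)`. The tangents of
the concave function `log ∘ cos` at `-b` and `b` turn this into `0 < log ‖u‖ + τ * arg u` and
`τ * (arg u - 2 * b) ≤ log ‖u‖`. In the sum over the permuted set the logarithms cancel and the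
arguments add up to `2 * π * k` for an integer `k`. The first inequality gives `0 < τ * k`, so
`1 ≤ |k|`, and the second one then says that there are at least `π / |b|` indices.
-/

open Real

lemma exists_finset_nonempty_bijOn_self {α : Type*} [Finite α] [Nonempty α] (f : α → α) :
    ∃ T : Finset α, T.Nonempty ∧ Set.BijOn f T T := by
  obtain ⟨x⟩ := ‹Nonempty α›
  obtain ⟨i, j, hij, h⟩ : ∃ i j, i < j ∧ f^[i] x = f^[j] x := by
    obtain ⟨i, j, hne, h⟩ := Finite.exists_ne_map_eq_of_infinite fun k : ℕ => f^[k] x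
    rcases hne.lt_or_gt with hlt | hlt
    exacts [⟨i, j, hlt, h⟩, ⟨j, i, hlt, h.symm⟩]
  have hperiodic : f^[i] x ∈ Function.periodicPts f := by
    refine Function.mk_mem_periodicPts (Nat.sub_pos_of_lt hij) ?_
    rw [Function.IsPeriodicPt, Function.IsFixedPt, ← Function.iterate_add_apply,
      Nat.sub_add_cancel hij.le, h]
  refine ⟨(Set.toFinite (Function.periodicPts f)).toFinset,
    ⟨f^[i] x, by simpa using hperiodic⟩, ?_⟩
  simpa using Function.bijOn_periodicPts f

lemma prod_div_eq_one_of_bijOn {α G : Type*} [CommGroupWithZero G] {f : α → α} {T : Finset α}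
    (hf : Set.BijOn f T T) {w : α → G} (hw : ∀ i ∈ T, w i ≠ 0) :
    ∏ i ∈ T, w (f i) / w i = 1 := by
  have hreindex : ∏ i ∈ T, w (f i) = ∏ i ∈ T, w i :=
    Finset.prod_nbij f hf.mapsTo hf.injOn hf.surjOn fun _ _ => rfl
  rw [Finset.prod_div_distrib, hreindex, div_self (Finset.prod_ne_zero_iff.2 hw)]

lemma exists_ne_zero_and_nonneg_of_sum_smul {ι R E : Type*} [Ring R] [LinearOrder R]
    [IsStrictOrderedRing R] [AddCommMonoid E] [Module R E] {s : Finset ι} {c : ι → R} {v : ι → E}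
    (hc : ∀ i ∈ s, v i ≠ 0 → 0 ≤ c i) (hsum : ∑ i ∈ s, c i • v i ≠ 0)
    (l : E →ₗ[R] R) (hl : 0 ≤ l (∑ i ∈ s, c i • v i)) :
    ∃ i ∈ s, v i ≠ 0 ∧ 0 ≤ l (v i) := by
  by_contra! hneg
  have hterm : ∀ i ∈ s, c i * l (v i) ≤ 0 := fun i hi => by
    by_cases hv : v i = 0
    · simp [hv]
    · exact mul_nonpos_of_nonneg_of_nonpos (hc i hi hv) (hneg i hi hv).le
  have hzero : ∑ i ∈ s, c i * l (v i) = 0 :=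
    (Finset.sum_nonpos hterm).antisymm (by simpa using hl)
  refine hsum (Finset.sum_eq_zero fun i hi => ?_)
  by_cases hv : v i = 0
  · rw [hv, smul_zero]
  · have hci := (Finset.sum_eq_zero_iff_of_nonpos hterm).1 hzero i hi
    rw [(mul_eq_zero.1 hci).resolve_right (hneg i hi hv).ne, zero_smul]

lemma lt_add_deriv_mul_sub_of_strictConcaveOn {S : Set ℝ} {f : ℝ → ℝ} {f' x y : ℝ}
    (hfc : StrictConcaveOn ℝ S f) (hx : x ∈ S) (hy : y ∈ S) (hne : y ≠ x)
    (hf : HasDerivAt f f' x) : f y < f x + f' * (y - x) := by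
  rcases hne.lt_or_gt with hlt | hlt
  · have hslope := hfc.lt_slope_of_hasDerivAt hy hx hlt hf
    rw [slope_def_field, lt_div_iff₀ (sub_pos.2 hlt)] at hslope
    linarith
  · have hslope := hfc.slope_lt_of_hasDerivAt hx hy hlt hf
    rw [slope_def_field, div_lt_iff₀ (sub_pos.2 hlt)] at hslope
    linarith

lemma hasDerivAt_log_cos {t : ℝ} (ht : cos t ≠ 0) : HasDerivAt (fun x => log (cos x)) (-tan t) t :=
  ((hasDerivAt_cos t).log ht).congr_deriv (by rw [tan_eq_sin_div_cos, neg_div])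

lemma strictConcaveOn_log_cos :
    StrictConcaveOn ℝ (Set.Ioo (-(π / 2)) (π / 2)) fun t => log (cos t) := by
  have hderiv : ∀ t ∈ Set.Ioo (-(π / 2)) (π / 2), HasDerivAt (fun x => log (cos x)) (-tan t) t :=
    fun t ht => hasDerivAt_log_cos (cos_pos_of_mem_Ioo ht).ne'
  refine StrictAntiOn.strictConcaveOn_of_deriv (convex_Ioo _ _)
    (fun t ht => (hderiv t ht).continuousAt.continuousWithinAt) ?_
  rw [interior_Ioo]
  intro s hs t ht hst
  rw [(hderiv s hs).deriv, (hderiv t ht).deriv]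
  exact neg_lt_neg (strictMonoOn_tan hs ht hst)

lemma log_cos_lt_tangent {s t : ℝ} (hs : s ∈ Set.Ioo (-(π / 2)) (π / 2))
    (ht : t ∈ Set.Ioo (-(π / 2)) (π / 2)) (hne : t ≠ s) :
    log (cos t) < log (cos s) - tan s * (t - s) := by
  have h := lt_add_deriv_mul_sub_of_strictConcaveOn strictConcaveOn_log_cos hs ht hne
    (hasDerivAt_log_cos (cos_pos_of_mem_Ioo hs).ne')
  linarith

section HalfPlane

variable {u : ℂ} {τ : ℝ}

lemma cos_arctan_le_norm_mul_cos (h : 1 ≤ u.re + τ * u.im) :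
    cos (arctan τ) ≤ ‖u‖ * cos (u.arg - arctan τ) := by
  have hcos := cos_arctan_pos τ
  have hsin : sin (arctan τ) = τ * cos (arctan τ) := by
    rw [← tan_mul_cos hcos.ne', tan_arctan]
  calc cos (arctan τ) ≤ (u.re + τ * u.im) * cos (arctan τ) := le_mul_of_one_le_left hcos.le h
    _ = ‖u‖ * cos (u.arg - arctan τ) := by
      rw [cos_sub, hsin, ← Complex.norm_mul_cos_arg u, ← Complex.norm_mul_sin_arg u]
      ring

lemma arg_sub_arctan_mem_Ioo (h : 1 ≤ u.re + τ * u.im) :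
    u.arg - arctan τ ∈ Set.Ioo (-(π / 2)) (π / 2) := by
  have hcos : 0 < cos (u.arg - arctan τ) :=
    pos_of_mul_pos_right ((cos_arctan_pos τ).trans_le (cos_arctan_le_norm_mul_cos h))
      (norm_nonneg u)
  rw [Set.mem_Ioo, ← abs_lt]
  by_contra! hge
  have hle : |u.arg - arctan τ| ≤ π + π / 2 := (abs_sub _ _).trans
    (add_le_add (Complex.abs_arg_le_pi u) (abs_lt.2 (arctan_mem_Ioo τ)).le)
  rw [← cos_abs] at hcos
  exact hcos.not_ge (cos_nonpos_of_pi_div_two_le_of_le hge (by linarith))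

lemma log_cos_arctan_sub_log_cos_le_log_norm (h : 1 ≤ u.re + τ * u.im) :
    log (cos (arctan τ)) - log (cos (u.arg - arctan τ)) ≤ log ‖u‖ := by
  have hcos := cos_pos_of_mem_Ioo (arg_sub_arctan_mem_Ioo h)
  rw [← log_div (cos_arctan_pos τ).ne' hcos.ne']
  exact log_le_log (div_pos (cos_arctan_pos τ) hcos)
    ((div_le_iff₀ hcos).2 (cos_arctan_le_norm_mul_cos h))

lemma log_norm_add_mul_arg_pos (h : 1 ≤ u.re + τ * u.im) (hu : u ≠ 1) :
    0 < log ‖u‖ + τ * u.arg := by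
  by_cases harg : u.arg = 0
  · have him : u.im = 0 := (Complex.arg_eq_zero_iff.1 harg).2
    have hlt : 1 < u.re := lt_of_le_of_ne (by simpa [him] using h) fun h1 =>
      hu (Complex.ext h1.symm him)
    rw [harg, mul_zero, add_zero]
    exact log_pos (hlt.trans_le (Complex.re_le_norm u))
  · have htangent := log_cos_lt_tangent (arctan_mem_Ioo (-τ)) (arg_sub_arctan_mem_Ioo h)
      (by rw [arctan_neg]; contrapose! harg; linarith)
    rw [tan_arctan, arctan_neg, cos_neg] at htangent
    linarith [log_cos_arctan_sub_log_cos_le_log_norm h]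

lemma mul_arg_sub_two_mul_arctan_le_log_norm (h : 1 ≤ u.re + τ * u.im) :
    τ * (u.arg - 2 * arctan τ) ≤ log ‖u‖ := by
  have hnorm := log_cos_arctan_sub_log_cos_le_log_norm h
  rcases eq_or_ne (u.arg - arctan τ) (arctan τ) with heq | hne
  · rw [heq, sub_self] at hnorm
    rwa [show u.arg - 2 * arctan τ = 0 by linarith, mul_zero]
  · have htangent := log_cos_lt_tangent (arctan_mem_Ioo τ) (arg_sub_arctan_mem_Ioo h) hne
    rw [tan_arctan] at htangent
    linarith

end HalfPlane

lemma exists_sum_arg_eq_of_prod_eq_one {ι : Type*} {T : Finset ι} {u : ι → ℂ}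
    (hprod : ∏ i ∈ T, u i = 1) : ∃ k : ℤ, ∑ i ∈ T, (u i).arg = 2 * π * k := by
  have hu : ∀ i ∈ T, u i ≠ 0 := Finset.prod_ne_zero_iff.1 (hprod ▸ one_ne_zero)
  have hexp : Complex.exp (∑ i ∈ T, Complex.log (u i)) = 1 := by
    rw [Complex.exp_sum, Finset.prod_congr rfl fun i hi => Complex.exp_log (hu i hi), hprod]
  obtain ⟨k, hk⟩ := Complex.exp_eq_one_iff.1 hexp
  refine ⟨k, ?_⟩
  simpa [Complex.log_im, mul_comm] using congrArg Complex.im hk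

lemma sum_log_norm_eq_zero_of_prod_eq_one {ι : Type*} {T : Finset ι} {u : ι → ℂ}
    (hprod : ∏ i ∈ T, u i = 1) : ∑ i ∈ T, log ‖u i‖ = 0 := by
  have hu : ∀ i ∈ T, u i ≠ 0 := Finset.prod_ne_zero_iff.1 (hprod ▸ one_ne_zero)
  rw [← log_prod fun i hi => norm_ne_zero_iff.2 (hu i hi), ← norm_prod, hprod, norm_one, log_one]

theorem pi_le_card_mul_abs_arctan_of_prod_eq_one {ι : Type*} {T : Finset ι} {u : ι → ℂ} {τ : ℝ}
    (hT : T.Nonempty) (hprod : ∏ i ∈ T, u i = 1) (hne : ∀ i ∈ T, u i ≠ 1)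
    (h : ∀ i ∈ T, 1 ≤ (u i).re + τ * (u i).im) : π ≤ T.card * |arctan τ| := by
  obtain ⟨k, hk⟩ := exists_sum_arg_eq_of_prod_eq_one hprod
  have hlog := sum_log_norm_eq_zero_of_prod_eq_one hprod
  have hpos : 0 < τ * (2 * π * k) := by
    have hsum := Finset.sum_pos (fun i hi => log_norm_add_mul_arg_pos (h i hi) (hne i hi)) hT
    rwa [Finset.sum_add_distrib, ← Finset.mul_sum, hlog, hk, zero_add] at hsum
  have hle : τ * (2 * π * k - T.card * (2 * arctan τ)) ≤ 0 := by
    have hsum := Finset.sum_le_sum fun i hi => mul_arg_sub_two_mul_arctan_le_log_norm (h i hi)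
    rwa [hlog, ← Finset.mul_sum, Finset.sum_sub_distrib, hk, Finset.sum_const, nsmul_eq_mul] at hsum
  have hturn : 1 ≤ |(k : ℝ)| := by
    have hk0 : k ≠ 0 := by rintro rfl; simp at hpos
    exact_mod_cast Int.one_le_abs hk0
  have hτ : 0 < |τ| := abs_pos.2 (left_ne_zero_of_mul hpos.ne')
  have habs : |τ| * (2 * π * |(k : ℝ)|) ≤ |τ| * (T.card * (2 * |arctan τ|)) := by
    calc |τ| * (2 * π * |(k : ℝ)|) = τ * (2 * π * k) := by
          rw [← abs_of_pos hpos, abs_mul, abs_mul, abs_of_pos two_pi_pos]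
      _ ≤ τ * (T.card * (2 * arctan τ)) := by linarith
      _ ≤ |τ * (T.card * (2 * arctan τ))| := le_abs_self _
      _ = |τ| * (T.card * (2 * |arctan τ|)) := by simp [abs_mul]
  have hcard : 2 * π * |(k : ℝ)| ≤ T.card * (2 * |arctan τ|) := le_of_mul_le_mul_left habs hτ
  linarith [le_mul_of_one_le_right two_pi_pos.le hturn]

lemma inv_abs_le_cot_of_le_abs_arctan {c t : ℝ} (hc : 0 < c) (h : c ≤ |arctan t|) :
    |t|⁻¹ ≤ cot c := by
  have harctan : |arctan t| = arctan |t| := by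
    rcases abs_cases t with ⟨ht, h0⟩ | ⟨ht, h0⟩
    · rw [ht, abs_of_nonneg (arctan_nonneg.2 h0)]
    · rw [ht, arctan_neg, abs_of_neg (arctan_lt_zero.2 h0)]
  have hc2 : c < π / 2 := (h.trans_eq harctan).trans_lt (arctan_lt_pi_div_two _)
  rw [← tan_inv_eq_cot]
  refine inv_anti₀ (tan_pos_of_pos_of_lt_pi_div_two hc hc2) ?_
  rwa [← arctan_le_arctan_iff, arctan_tan (by linarith) hc2, ← harctan]

lemma cot_pi_div_natCast_nonneg (n : ℕ) : 0 ≤ cot (π / n) := by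
  rcases Nat.lt_or_ge n 2 with hn | hn
  · interval_cases n <;> simp [cot_eq_cos_div_sin]
  · rw [← tan_inv_eq_cot]
    refine inv_nonneg.2 (tan_nonneg_of_nonneg_of_le_pi_div_two (by positivity) ?_)
    gcongr
    exact_mod_cast hn

/-- `w` is an eigenvector with eigenvalue `z` of the backward equation, whose matrix is the
transpose of that of the master equation: `q i j` is again the rate of the transition from `j` to
`i`, and the diagonal of `q` does not contribute. -/
def IsBackwardEigenvector {ι : Type*} [Fintype ι] (q : ι → ι → ℝ) (z : ℂ) (w : ι → ℂ) : Prop :=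
  w ≠ 0 ∧ ∀ j, ∑ i, (q i j : ℂ) * (w i - w j) = z * w j

namespace IsBackwardEigenvector

variable {ι : Type*} [Fintype ι] {q : ι → ι → ℝ} {z : ℂ} {w : ι → ℂ}

lemma exists_div_ne_one_and_one_le (hw : IsBackwardEigenvector q z w)
    (hq : ∀ i j, i ≠ j → 0 ≤ q i j) (hz : z.im ≠ 0) {j : ι} (hwj : w j ≠ 0) :
    ∃ i, w i / w j ≠ 1 ∧ 1 ≤ (w i / w j).re + -(z.re / z.im) * (w i / w j).im := by
  have hcomb : ∑ i, q i j • (w i / w j - 1) = z := by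
    rw [← mul_div_cancel_right₀ z hwj, ← hw.2 j, Finset.sum_div]
    refine Finset.sum_congr rfl fun i _ => ?_
    rw [Complex.real_smul, ← div_self hwj, ← sub_div, mul_div_assoc]
  have hc : ∀ i ∈ Finset.univ, w i / w j - 1 ≠ 0 → 0 ≤ q i j := fun i _ hi =>
    hq i j fun hij => hi (by rw [hij, div_self hwj, sub_self])
  let l : ℂ →ₗ[ℝ] ℝ := Complex.reLm + -(z.re / z.im) • Complex.imLm
  have hl : l z = 0 := by simp [l, hz]
  obtain ⟨i, -, hne, hi⟩ := exists_ne_zero_and_nonneg_of_sum_smul hc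
    (hcomb ▸ fun h => hz (by simp [h])) l (by rw [hcomb, hl])
  refine ⟨i, sub_ne_zero.1 hne, ?_⟩
  simp only [l, LinearMap.add_apply, LinearMap.smul_apply, Complex.reLm_coe, Complex.imLm_coe,
    Complex.sub_re, Complex.sub_im, Complex.one_re, Complex.one_im, smul_eq_mul, sub_zero] at hi
  linarith

theorem pi_le_card_mul_abs_arctan (hw : IsBackwardEigenvector q z w)
    (hq : ∀ i j, i ≠ j → 0 ≤ q i j) (hz : z.im ≠ 0) :
    π ≤ Fintype.card ι * |arctan (z.re / z.im)| := by
  classical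
  choose! f hne hstep using fun j => hw.exists_div_ne_one_and_one_le hq hz (j := j)
  have hf : ∀ j, w j ≠ 0 → w (f j) ≠ 0 := fun j hj h0 => by
    have hle := hstep j hj
    norm_num [h0] at hle
  obtain ⟨k, hk⟩ := Function.ne_iff.1 hw.1
  have : Nonempty {j // w j ≠ 0} := ⟨⟨k, hk⟩⟩
  obtain ⟨T, hT, hbij⟩ := exists_finset_nonempty_bijOn_self
    fun j : {j // w j ≠ 0} => (⟨f j, hf j j.2⟩ : {j // w j ≠ 0})
  have hcard : π ≤ T.card * |arctan (-(z.re / z.im))| :=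
    pi_le_card_mul_abs_arctan_of_prod_eq_one hT
      (prod_div_eq_one_of_bijOn hbij (w := fun j => w j) fun j _ => j.2)
      (fun j _ => hne j j.2) fun j _ => hstep j j.2
  rw [arctan_neg, abs_neg] at hcard
  refine hcard.trans (mul_le_mul_of_nonneg_right ?_ (abs_nonneg _))
  exact_mod_cast T.card_le_univ.trans (Fintype.card_subtype_le _)

theorem re_ne_zero_and_abs_im_div_abs_re_le_cot (hw : IsBackwardEigenvector q z w)
    (hq : ∀ i j, i ≠ j → 0 ≤ q i j) (hz : z ≠ 0) :
    z.re ≠ 0 ∧ |z.im| / |z.re| ≤ cot (π / Fintype.card ι) := by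
  by_cases him : z.im = 0
  · refine ⟨fun hre => hz (Complex.ext hre him), ?_⟩
    rw [him, abs_zero, zero_div]
    exact cot_pi_div_natCast_nonneg _
  · have hpi := hw.pi_le_card_mul_abs_arctan hq him
    have hcard : (0 : ℝ) < Fintype.card ι :=
      pos_of_mul_pos_left (pi_pos.trans_le hpi) (abs_nonneg _)
    refine ⟨fun hre => ?_, ?_⟩
    · rw [hre, zero_div, arctan_zero, abs_zero, mul_zero] at hpi
      exact pi_pos.not_ge hpi
    · rw [← inv_div, ← abs_div]
      exact inv_abs_le_cot_of_le_abs_arctan (by positivity) ((div_le_iff₀' hcard).2 hpi)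

end IsBackwardEigenvector

section MasterMatrix

lemma hasEigenvalue_toLin'_transpose_iff {K n : Type*} [Field K] [Fintype n] [DecidableEq n]
    (A : Matrix n n K) (μ : K) :
    Module.End.HasEigenvalue (Matrix.toLin' A.transpose) μ ↔
      Module.End.HasEigenvalue (Matrix.toLin' A) μ := by
  rw [Module.End.hasEigenvalue_iff_mem_spectrum, Module.End.hasEigenvalue_iff_mem_spectrum,
    Matrix.spectrum_toLin', Matrix.spectrum_toLin', spectrum.mem_iff, spectrum.mem_iff,
    ← Matrix.isUnit_transpose, Matrix.transpose_sub, Matrix.transpose_transpose,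
    Matrix.algebraMap_eq_diagonal, Matrix.diagonal_transpose]

variable {n : ℕ}

lemma transpose_map_masterMatrix_mulVec (q : Fin n → Fin n → ℝ) (w : Fin n → ℂ) (j : Fin n) :
    ((masterMatrix q).map (fun x : ℝ => (x : ℂ))).transpose.mulVec w j =
      ∑ i, (q i j : ℂ) * (w i - w j) := by
  have hne : Finset.univ.filter (fun i => i ≠ j) = Finset.univ.erase j := by ext; simp
  simp only [Matrix.mulVec, dotProduct, Matrix.transpose_apply, Matrix.map_apply]
  rw [← Finset.add_sum_erase _ _ (Finset.mem_univ j),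
    ← Finset.add_sum_erase _ (fun i => (q i j : ℂ) * (w i - w j)) (Finset.mem_univ j)]
  have hdiag : masterMatrix q j j = -∑ i ∈ Finset.univ.erase j, q i j := by
    simp [masterMatrix, hne]
  have hoffdiag : ∀ i ∈ Finset.univ.erase j, (masterMatrix q i j : ℂ) * w i = q i j * w i :=
    fun i hi => by simp [masterMatrix, Finset.ne_of_mem_erase hi]
  rw [hdiag, Finset.sum_congr rfl hoffdiag]
  simp only [mul_sub, Finset.sum_sub_distrib, ← Finset.sum_mul]
  push_cast
  ring

lemma isComplexEigenvalue_masterMatrix_iff {q : Fin n → Fin n → ℝ} {z : ℂ} :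
    IsComplexEigenvalue (masterMatrix q) z ↔ ∃ w, IsBackwardEigenvector q z w := by
  have heigenvector (w : Fin n → ℂ) : Module.End.HasEigenvector (Matrix.toLin'
      ((masterMatrix q).map (fun x : ℝ => (x : ℂ))).transpose) z w ↔
        IsBackwardEigenvector q z w := by
    rw [Module.End.hasEigenvector_iff, Module.End.mem_eigenspace_iff, Matrix.toLin'_apply,
      funext_iff, and_comm, IsBackwardEigenvector]
    simp only [transpose_map_masterMatrix_mulVec, Pi.smul_apply, smul_eq_mul]
  rw [IsComplexEigenvalue, ← hasEigenvalue_toLin'_transpose_iff]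
  simp only [← heigenvector]
  exact ⟨fun h => h.exists_hasEigenvector,
    fun ⟨_, hw⟩ => Module.End.hasEigenvalue_of_hasEigenvector hw⟩

lemma isComplexEigenvalue_masterMatrix_cycleRate (hn : n ≠ 0) (r : ℝ) :
    IsComplexEigenvalue (masterMatrix (cycleRate n r))
      (-(r : ℂ) * (1 - Complex.exp (2 * π * Complex.I / n))) := by
  have : NeZero n := ⟨hn⟩
  set ω := Complex.exp (2 * π * Complex.I / n)
  have hpow : ω ^ n = 1 := (Complex.isPrimitiveRoot_exp n hn).pow_eq_one
  refine isComplexEigenvalue_masterMatrix_iff.2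
    ⟨fun j => ω ^ (j : ℕ), Function.ne_iff.2 ⟨0, by simp⟩, fun j => ?_⟩
  rw [Finset.sum_eq_single ⟨(j + 1) % n, Nat.mod_lt _ hn.bot_lt⟩]
  · simp only [cycleRate, if_true]
    rw [← pow_eq_pow_mod _ hpow]
    ring
  · intro i _ hi
    have hne : (i : ℕ) ≠ (j + 1) % n := fun h => hi (Fin.ext h)
    simp [cycleRate, hne]
  · simp

end MasterMatrix

lemma neg_mul_one_sub_exp_two_mul_I (r c : ℝ) :
    -(r : ℂ) * (1 - Complex.exp ((2 * c : ℝ) * Complex.I)) =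
      ⟨-(2 * r * sin c * sin c), 2 * r * sin c * cos c⟩ := by
  apply Complex.ext
  · rw [← Complex.ofReal_neg, Complex.re_ofReal_mul, Complex.sub_re, Complex.one_re,
      Complex.exp_ofReal_mul_I_re, cos_two_mul, cos_sq']
    ring
  · rw [← Complex.ofReal_neg, Complex.im_ofReal_mul, Complex.sub_im, Complex.one_im,
      Complex.exp_ofReal_mul_I_im, sin_two_mul]
    ring

lemma re_ne_zero_and_abs_im_div_abs_re_eq_cot {n : ℕ} (hn : 2 ≤ n) {r : ℝ} (hr : r ≠ 0) {z : ℂ}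
    (hz : z = -(r : ℂ) * (1 - Complex.exp (2 * π * Complex.I / n))) :
    z.re ≠ 0 ∧ |z.im| / |z.re| = cot (π / n) := by
  have hsin : sin (π / n) ≠ 0 :=
    (sin_pos_of_pos_of_lt_pi (by positivity) (div_lt_self pi_pos (by exact_mod_cast hn))).ne'
  have hzc : z = ⟨-(2 * r * sin (π / n) * sin (π / n)), 2 * r * sin (π / n) * cos (π / n)⟩ := by
    rw [hz, ← neg_mul_one_sub_exp_two_mul_I]
    push_cast
    ring_nf
  have hfactor : 2 * r * sin (π / n) ≠ 0 := by positivity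
  rw [hzc]
  refine ⟨neg_ne_zero.2 (mul_ne_zero hfactor hsin), ?_⟩
  rw [abs_neg, ← abs_div, mul_div_mul_left _ _ hfactor, ← cot_eq_cos_div_sin,
    abs_of_nonneg (cot_pi_div_natCast_nonneg n)]

theorem mainTheorem1 (n : ℕ) :
    (∀ q : Fin n → Fin n → ℝ, (∀ i j, i ≠ j → 0 ≤ q i j) →
      ∀ z : ℂ, IsComplexEigenvalue (masterMatrix q) z → z ≠ 0 →
        z.re ≠ 0 ∧ |z.im| / |z.re| ≤ Real.cot (Real.pi / n)) ∧
    (2 ≤ n → ∀ r : ℝ, 0 < r → ∀ z : ℂ,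
      z = -(r : ℂ) * (1 - Complex.exp (2 * Real.pi * Complex.I / n)) →
        IsComplexEigenvalue (masterMatrix (cycleRate n r)) z ∧ z ≠ 0 ∧
        z.re ≠ 0 ∧ |z.im| / |z.re| = Real.cot (Real.pi / n)) := by
  refine ⟨fun q hq z hz hz0 => ?_, fun hn r hr z hz => ?_⟩
  · obtain ⟨w, hw⟩ := isComplexEigenvalue_masterMatrix_iff.1 hz
    simpa only [Fintype.card_fin] using hw.re_ne_zero_and_abs_im_div_abs_re_le_cot hq hz0
  · obtain ⟨hre, hratio⟩ := re_ne_zero_and_abs_im_div_abs_re_eq_cot hn hr.ne' hz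
    exact ⟨hz ▸ isComplexEigenvalue_masterMatrix_cycleRate (by lia) r,
      fun h => hre (by rw [h, Complex.zero_re]), hre, hratio⟩
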